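/- For $n\ge 1$ put $\delta^{(n)}_{\mathbb C}(z_1,\dots,z_n):=\frac{1}{(2\pi i)^n}\frac{1}{z_1\cdots z_n}$. Let $\bar Z_i=(\bar Z_{i\alpha})_{\alpha=0,\dots,3}=(\tilde\pi_{i0},\tilde\pi_{i1},\tilde\omega_i^{0'},\tilde\omega_i^{1'})\in\mathbb C^4$ for $i=1,2,3$, put $\langle ij\rangle:=\tilde\pi_{i0}\tilde\pi_{j1}-\tilde\pi_{i1}\tilde\pi_{j0}$, and $$\zeta^{A'}:=\langle23\rangle\tilde\omega_1^{A'}+\langle31\rangle\tilde\omega_2^{A'}+\langle12\rangle\tilde\omega_3^{A'}\qquad(A'=0',1').$$ Assume $\langle12\rangle,\langle23\rangle,\langle31\rangle\neq0$. The collinear delta function is the contour integral $$\Delta^{(2)}(\bar Z_1,\bar Z_2,\bar Z_3):=\int_\gamma\frac{dv}{v}\wedge\frac{dw}{w}\;\delta^{(4)}_{\mathbb C}\big(\bar Z_{1\alpha}-v\bar Z_{2\alpha}-w\bar Z_{3\alpha}\big),$$ where $\gamma$ surrounds the point $(v,w)\in\mathbb C^2$ with $\bar Z_{10}-v\bar Z_{20}-w\bar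 Z_{30}=0$ and $\bar Z_{11}-v\bar Z_{21}-w\bar Z_{31}=0$: with $a=v\bar Z_{20}+w\bar Z_{30}$ and $b=v\bar Z_{21}+w\bar Z_{31}$, it is the torus $a=\bar Z_{10}+\varepsilon_0e^{i\theta_0}$, $b=\bar Z_{11}+\varepsilon_1e^{i\theta_1}$ ($0\le\theta_0,\theta_1\le2\pi$), oriented by $d\theta_0\wedge d\theta_1$. The radii $\varepsilon_0,\varepsilon_1>0$ are called admissible if none of $v$, $w$, $\bar Z_{12}-v\bar Z_{22}-w\bar Z_{32}$, $\bar Z_{13}-v\bar Z_{23}-w\bar Z_{33}$ vanishes at any point with $|a-\bar Z_{10}|\le\varepsilon_0$ and $|b-\bar Z_{11}|\le\varepsilon_1$. (i) If $\zeta^{0'}\ne0$ and $\zeta^{1'}\neq0$, then all sufficiently small $\varepsilon_0,\varepsilon_1>0$ are admissible, and for all admissible radii the integral converges absolutely and $$\Delta^{(2)}(\bar Z_1,\bar Z_2,\bar Z_3)=\frac{\langle23\rangle^3}{\langle31\rangle\langle12\rangle}\,\delta^{(2)}_{\mathbb C}\big(\langle23\rangle\tilde\omega_1^{A'}+\langle31\rangle\tilde\omega_2^{A'}+\langle12\rangle\tilde\omega_3^{A'}\big).$$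 (ii) For fixed $\tilde\pi_1,\tilde\pi_2,\tilde\pi_3$, $\Delta^{(2)}$ as a function of the homogeneous coordinates $(\zeta^{0'},\zeta^{1'})$ of $\mathbb{CP}^1$ is a representative of a nonzero element of $H^1(\mathbb{CP}^1,\mathcal O(-2))$: it is the component on $U_{0'}\cap U_{1'}$ of a Čech $1$-cocycle of $\mathcal O(-2)$ for the covering $U_{A'}=\{\zeta^{A'}\neq0\}$, and this cocycle is not a coboundary. -/

import Mathlib

noncomputable section

namespace TwistorDelta

/-! ### Delta functions and the contour integral -/

/-- The delta function on `ℂⁿ`: `(2πi)⁻ⁿ / (z₁ z₂ ⋯ zₙ)`. -/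
def complexDelta (n : ℕ) (z : Fin n → ℂ) : ℂ :=
  1 / (2 * (Real.pi : ℂ) * Complex.I) ^ n * (1 / ∏ i, z i)

/-- Homogeneous coordinates `(π̃₀, π̃₁, ω̃^{0'}, ω̃^{1'})` of a point of dual twistor space. -/
def twistor (p o : Fin 2 → ℂ) : Fin 4 → ℂ := ![p 0, p 1, o 0, o 1]

/-- The spinor product `⟨i j⟩ = π̃_{i0} π̃_{j1} - π̃_{i1} π̃_{j0}`. -/
def bracket (p q : Fin 2 → ℂ) : ℂ := p 0 * q 1 - p 1 * q 0

/-- The integrand of `∫ F dz₁ ∧ ⋯ ∧ dzₙ` over the map `γ`, pulled back to the parameters `θ`: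
`F (γ θ)` times the Jacobian determinant `det (∂γ_i / ∂θ_j)`. -/
def pullbackForm {n : ℕ} (F : (Fin n → ℂ) → ℂ) (γ : (Fin n → ℝ) → (Fin n → ℂ))
    (θ : Fin n → ℝ) : ℂ :=
  F (γ θ) * (Matrix.of fun i j : Fin n => fderiv ℝ γ θ (Pi.single j 1) i).det

/-- The parameter cube `[0, 2π]ⁿ`. -/
def paramCube (n : ℕ) : Set (Fin n → ℝ) := Set.Icc 0 (fun _ => 2 * Real.pi)

/-- The integral of the form `F dz₁ ∧ ⋯ ∧ dzₙ` over the map `γ : [0, 2π]ⁿ → ℂⁿ`. -/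
def contourIntegral {n : ℕ} (F : (Fin n → ℂ) → ℂ) (γ : (Fin n → ℝ) → (Fin n → ℂ)) : ℂ :=
  ∫ θ in paramCube n, pullbackForm F γ θ

/-- Absolute convergence of `contourIntegral F γ`. -/
def ContourIntegrable {n : ℕ} (F : (Fin n → ℂ) → ℂ) (γ : (Fin n → ℝ) → (Fin n → ℂ)) : Prop :=
  MeasureTheory.IntegrableOn (pullbackForm F γ) (paramCube n)

/-- `(1/v) (1/w) δ⁽⁴⁾(Z₁ - v Z₂ - w Z₃)` as a function of `x = (v, w)`. -/
def collinearIntegrand (Z₁ Z₂ Z₃ : Fin 4 → ℂ) (x : Fin 2 → ℂ) : ℂ :=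
  1 / x 0 * (1 / x 1) * complexDelta 4 (Z₁ - x 0 • Z₂ - x 1 • Z₃)

/-- The torus of all `(v, w)` with
`v Z₂₀ + w Z₃₀ = Z₁₀ + ε₀ e^{iθ₀}` and `v Z₂₁ + w Z₃₁ = Z₁₁ + ε₁ e^{iθ₁}`,
parametrised (and oriented) by `(θ₀, θ₁)`. -/
def collinearContour (Z₁ Z₂ Z₃ : Fin 4 → ℂ) (ε : Fin 2 → ℝ) (θ : Fin 2 → ℝ) : Fin 2 → ℂ :=
  Matrix.mulVec (!![Z₂ 0, Z₃ 0; Z₂ 1, Z₃ 1])⁻¹ (torusMap ![Z₁ 0, Z₁ 1] ε θ)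

/-- The radii are positive, and the closed region bounded by the torus meets none of the polar
divisors of the integrand other than the two that define the surrounded point. -/
def SurroundsOnly (Z₁ Z₂ Z₃ : Fin 4 → ℂ) (ε : Fin 2 → ℝ) : Prop :=
  0 < ε 0 ∧ 0 < ε 1 ∧ ∀ v w : ℂ,
    ‖Z₁ 0 - v * Z₂ 0 - w * Z₃ 0‖ ≤ ε 0 → ‖Z₁ 1 - v * Z₂ 1 - w * Z₃ 1‖ ≤ ε 1 →
      v ≠ 0 ∧ w ≠ 0 ∧ Z₁ 2 - v * Z₂ 2 - w * Z₃ 2 ≠ 0 ∧ Z₁ 3 - v * Z₂ 3 - w * Z₃ 3 ≠ 0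

/-- The collinear delta function `Δ⁽²⁾(Z₁, Z₂, Z₃)`, computed on the torus of radii `ε`. -/
def collinearDelta (Z₁ Z₂ Z₃ : Fin 4 → ℂ) (ε : Fin 2 → ℝ) : ℂ :=
  contourIntegral (collinearIntegrand Z₁ Z₂ Z₃) (collinearContour Z₁ Z₂ Z₃ ε)

/-- The spinor `⟨23⟩ ω̃₁ + ⟨31⟩ ω̃₂ + ⟨12⟩ ω̃₃`. -/
def collinearArg (p₁ p₂ p₃ o₁ o₂ o₃ : Fin 2 → ℂ) : Fin 2 → ℂ :=
  bracket p₂ p₃ • o₁ + bracket p₃ p₁ • o₂ + bracket p₁ p₂ • o₃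

/-! ### Čech cohomology of `𝒪(k)` on projective space -/

/-- Complex projective space with homogeneous coordinates `z : Fin n → ℂ`, of dimension `n - 1`. -/
abbrev CP (n : ℕ) : Type := Projectivization ℂ (Fin n → ℂ)

/-- The cone (without the origin) over a subset of projective space. -/
def cone {n : ℕ} (U : Set (CP n)) : Set (Fin n → ℂ) :=
  {z | ∃ h : z ≠ 0, Projectivization.mk ℂ z h ∈ U}

/-- The open set `z_i ≠ 0` of projective space. -/
def chart {n : ℕ} (i : Fin n) : Set (CP n) := {x | x.rep i ≠ 0}

/-- Sections of `𝒪(k)` over `U`: holomorphic functions on the cone over `U`, homogeneous of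
degree `k`. Such a function is stored through its extension by zero to all of `ℂⁿ`. -/
def sections {n : ℕ} (k : ℤ) (U : Set (CP n)) : Submodule ℂ ((Fin n → ℂ) → ℂ) where
  carrier := {f | DifferentiableOn ℂ f (cone U) ∧
    (∀ z ∈ cone U, ∀ c : ℂ, c ≠ 0 → f (c • z) = c ^ k * f z) ∧ ∀ z, z ∉ cone U → f z = 0}
  add_mem' := by
    rintro f g ⟨hf, hf', hf0⟩ ⟨hg, hg', hg0⟩
    refine ⟨hf.add hg, fun z hz c hc => ?_, fun z hz => ?_⟩
    · simp only [Pi.add_apply, hf' z hz c hc, hg' z hz c hc]; ring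
    · simp only [Pi.add_apply, hf0 z hz, hg0 z hz, add_zero]
  zero_mem' := ⟨differentiableOn_const 0, by simp, by simp⟩
  smul_mem' := by
    rintro a f ⟨hf, hf', hf0⟩
    refine ⟨hf.const_smul a, fun z hz c hc => ?_, fun z hz => ?_⟩
    · simp only [Pi.smul_apply, smul_eq_mul, hf' z hz c hc]; ring
    · simp only [Pi.smul_apply, hf0 z hz, smul_zero]

theorem cone_mono {n : ℕ} {U V : Set (CP n)} (h : V ⊆ U) : cone V ⊆ cone U :=
  fun _ hz => ⟨hz.1, h hz.2⟩

theorem smul_mem_cone {n : ℕ} {U : Set (CP n)} {z : Fin n → ℂ} (hz : z ∈ cone U)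
    {c : ℂ} (hc : c ≠ 0) : c • z ∈ cone U := by
  obtain ⟨h, hU⟩ := hz
  refine ⟨smul_ne_zero hc h, ?_⟩
  have : Projectivization.mk ℂ (c • z) (smul_ne_zero hc h) = Projectivization.mk ℂ z h :=
    (Projectivization.mk_eq_mk_iff' ℂ _ _ _ _).2 ⟨c, rfl⟩
  rwa [this]

open Classical in
/-- Restriction of sections of `𝒪(k)` from `U` to `V ⊆ U`. -/
def restrict {n : ℕ} (k : ℤ) {U V : Set (CP n)} (h : V ⊆ U) :
    sections k U →ₗ[ℂ] sections k V where
  toFun f := ⟨(cone V).indicator f.1, by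
    obtain ⟨f, hf, hf', -⟩ := f
    refine ⟨(hf.mono (cone_mono h)).congr fun z hz => Set.indicator_of_mem hz f,
      fun z hz c hc => ?_, fun z hz => Set.indicator_of_notMem hz f⟩
    simp only [Set.indicator_of_mem hz, Set.indicator_of_mem (smul_mem_cone hz hc)]
    exact hf' z (cone_mono h hz) c hc⟩
  map_add' f g := Subtype.ext (Set.indicator_add (cone V) f.1 g.1)
  map_smul' a f := Subtype.ext (Set.indicator_const_smul (cone V) a f.1)

variable {n : ℕ} {ι : Type}

/-- Čech `0`-cochains of `𝒪(k)` for the family `U`. -/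
def Cochain0 (k : ℤ) (U : ι → Set (CP n)) : Type :=
  ∀ i, sections k (U i)

instance (k : ℤ) (U : ι → Set (CP n)) : AddCommGroup (Cochain0 k U) :=
  inferInstanceAs (AddCommGroup (∀ i, sections k (U i)))

instance (k : ℤ) (U : ι → Set (CP n)) : Module ℂ (Cochain0 k U) :=
  inferInstanceAs (Module ℂ (∀ i, sections k (U i)))

/-- Čech `1`-cochains. -/
def Cochain1 (k : ℤ) (U : ι → Set (CP n)) : Type :=
  ∀ i j, sections k (U i ∩ U j)

instance (k : ℤ) (U : ι → Set (CP n)) : AddCommGroup (Cochain1 k U) :=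
  inferInstanceAs (AddCommGroup (∀ i j, sections k (U i ∩ U j)))

instance (k : ℤ) (U : ι → Set (CP n)) : Module ℂ (Cochain1 k U) :=
  inferInstanceAs (Module ℂ (∀ i j, sections k (U i ∩ U j)))

/-- Čech `2`-cochains. -/
def Cochain2 (k : ℤ) (U : ι → Set (CP n)) : Type :=
  ∀ i j l, sections k (U i ∩ U j ∩ U l)

instance (k : ℤ) (U : ι → Set (CP n)) : AddCommGroup (Cochain2 k U) :=
  inferInstanceAs (AddCommGroup (∀ i j l, sections k (U i ∩ U j ∩ U l)))

instance (k : ℤ) (U : ι → Set (CP n)) : Module ℂ (Cochain2 k U) :=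
  inferInstanceAs (Module ℂ (∀ i j l, sections k (U i ∩ U j ∩ U l)))

/-- `(d g)_{ij} = g_j - g_i` on `U i ∩ U j`. -/
def d0 (k : ℤ) (U : ι → Set (CP n)) : Cochain0 k U →ₗ[ℂ] Cochain1 k U where
  toFun g := fun i j =>
    restrict k Set.inter_subset_right (g j) - restrict k Set.inter_subset_left (g i)
  map_add' g g' := by
    funext i j
    change restrict k _ (g j + g' j) - restrict k _ (g i + g' i) =
      (restrict k _ (g j) - restrict k _ (g i)) + (restrict k _ (g' j) - restrict k _ (g' i))
    simp only [map_add]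
    abel
  map_smul' a g := by
    funext i j
    change restrict k _ (a • g j) - restrict k _ (a • g i) =
      a • (restrict k _ (g j) - restrict k _ (g i))
    simp only [map_smul, smul_sub]

/-- `(d c)_{ijl} = c_{jl} - c_{il} + c_{ij}` on `U i ∩ U j ∩ U l`. -/
def d1 (k : ℤ) (U : ι → Set (CP n)) : Cochain1 k U →ₗ[ℂ] Cochain2 k U where
  toFun c := fun i j l =>
    restrict k (Set.inter_subset_inter_left (U l) Set.inter_subset_right) (c j l)
      - restrict k (Set.inter_subset_inter_left (U l) Set.inter_subset_left) (c i l)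
      + restrict k Set.inter_subset_left (c i j)
  map_add' c c' := by
    funext i j l
    change restrict k _ (c j l + c' j l) - restrict k _ (c i l + c' i l)
        + restrict k _ (c i j + c' i j) =
      (restrict k _ (c j l) - restrict k _ (c i l) + restrict k _ (c i j))
        + (restrict k _ (c' j l) - restrict k _ (c' i l) + restrict k _ (c' i j))
    simp only [map_add]
    abel
  map_smul' a c := by
    funext i j l
    change restrict k _ (a • c j l) - restrict k _ (a • c i l) + restrict k _ (a • c i j) =
      a • (restrict k _ (c j l) - restrict k _ (c i l) + restrict k _ (c i j))
    simp only [map_smul, smul_sub, smul_add]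

/-- Čech `1`-cocycles. -/
abbrev Cocycle1 (k : ℤ) (U : ι → Set (CP n)) : Submodule ℂ (Cochain1 k U) :=
  LinearMap.ker (d1 k U)

/-- The first Čech cohomology group of `𝒪(k)` for the family `U`: cocycles modulo coboundaries. -/
abbrev CechH1 (k : ℤ) (U : ι → Set (CP n)) : Type :=
  Cocycle1 k U ⧸ (LinearMap.range (d0 k U)).submoduleOf (Cocycle1 k U)

/-- The class of a cocycle. -/
def cechClass (k : ℤ) (U : ι → Set (CP n)) : Cocycle1 k U →ₗ[ℂ] CechH1 k U :=
  ((LinearMap.range (d0 k U)).submoduleOf (Cocycle1 k U)).mkQ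

end TwistorDelta

end

/-! ### Integrals over tori and their linear images -/

namespace TwistorDelta

/-! In the coordinates `a`, `b` the form `dv ∧ dw` is `da ∧ db / ⟨23⟩`, and the first two delta
factors are simple poles at the centre of a polydisc on which, for admissible radii, the rest is
holomorphic. Cauchy's formula (`torusIntegral_inv_prod_sub_mul`) cancels two of the four factors
`2πi` and evaluates the rest at the centre (`SurroundsOnly.collinearDelta_eq`). There the Schouten
identity gives `v = -⟨31⟩/⟨23⟩`, `w = -⟨12⟩/⟨23⟩`, and the two remaining arguments are
`ζ^{A'}/⟨23⟩`; counting powers of `⟨23⟩` gives the stated factor.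

The result is `K / (ζ₀ ζ₁)` with a nonzero `K` depending only on the `π̃`. Such a function generates
`H¹(𝒪(-2))`; by Liouville's theorem it is not a difference of sections over the two charts
(`invProdCochain_notMem_range`). -/

theorem norm_torusMap_sub {n : ℕ} {c : Fin n → ℂ} {R : Fin n → ℝ} (hR : ∀ i, 0 < R i)
    (θ : Fin n → ℝ) (i : Fin n) : ‖torusMap c R θ i - c i‖ = R i := by
  simp [torusMap, abs_of_pos (hR i)]

/-- Cauchy's integral formula on a polydisc. -/
theorem torusIntegral_inv_prod_sub_mul {n : ℕ} {c : Fin n → ℂ} {R : Fin n → ℝ}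
    (hR : ∀ i, 0 < R i) {h : (Fin n → ℂ) → ℂ}
    (hh : ∀ x : Fin n → ℂ, (∀ i, ‖x i - c i‖ ≤ R i) → DifferentiableAt ℂ h x) :
    torusIntegral (fun x => (∏ i, (x i - c i))⁻¹ * h x) c R =
      (2 * (Real.pi : ℂ) * Complex.I) ^ n * h c := by
  induction n with
  | zero => simp [torusIntegral_dim0]
  | succ n ih =>
    have htorus := norm_torusMap_sub (c := c) hR
    have hint : TorusIntegrable (fun x => (∏ i, (x i - c i))⁻¹ * h x) c R := by
      refine ContinuousOn.integrableOn_compact isCompact_Icc (Continuous.continuousOn ?_)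
      have hc : Continuous (torusMap c R) := by unfold torusMap; fun_prop
      refine Continuous.mul (Continuous.inv₀ (by fun_prop) fun θ => ?_) ?_
      · refine Finset.prod_ne_zero_iff.2 fun i _ => norm_pos_iff.1 ?_
        rw [htorus]; exact hR i
      · refine continuous_iff_continuousAt.2 fun θ => ContinuousAt.comp (g := h) ?_ hc.continuousAt
        exact (hh _ fun i => (htorus θ i).le).continuousAt
    rw [torusIntegral_succ hint]
    have hcons : ∀ x : ℂ, Fin.cons x (fun i : Fin n => c i.succ) =
        Function.update c 0 x := fun x => by
      funext i
      refine Fin.cases ?_ (fun j => ?_) i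
      · simp
      · simp
    have hinner : ∀ x ∈ Metric.sphere (c 0) (R 0),
        torusIntegral (fun y => (∏ i, ((Fin.cons x y : Fin (n + 1) → ℂ) i - c i))⁻¹ *
          h (Fin.cons x y)) (c ∘ Fin.succ) (R ∘ Fin.succ) =
        (x - c 0)⁻¹ • ((2 * (Real.pi : ℂ) * Complex.I) ^ n * h (Function.update c 0 x)) := by
      intro x hx
      -- The pole in the first variable is constant in the others, so it is absorbed into the
      -- function given to the induction hypothesis.
      have := ih (c := c ∘ Fin.succ) (R := R ∘ Fin.succ) (fun i => hR i.succ)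
        (h := fun y => (x - c 0)⁻¹ * h (Fin.cons x y)) ?_
      · rw [show Fin.cons x (c ∘ Fin.succ) = Function.update c 0 x from hcons x] at this
        rw [smul_eq_mul, mul_left_comm, ← this]
        congr 1
        funext y
        simp [Fin.prod_univ_succ]
        ring
      · intro y hy
        refine DifferentiableAt.const_mul ?_ _
        refine DifferentiableAt.comp (g := h) y (hh _ fun i => ?_) ?_
        · refine Fin.cases ?_ (fun j => ?_) i
          · simpa using (mem_sphere_iff_norm.1 hx).le
          · simpa using hy j
        · refine differentiableAt_pi.2 fun i => ?_
          refine Fin.cases ?_ (fun j => ?_) i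
          · simp
          · simp only [Fin.cons_succ]; fun_prop
    rw [circleIntegral.integral_congr (hR 0).le hinner]
    have hd : DiffContOnCl ℂ (fun x => (2 * (Real.pi : ℂ) * Complex.I) ^ n *
        h (Function.update c 0 x)) (Metric.ball (c 0) (R 0)) := by
      refine DifferentiableOn.diffContOnCl fun x hx => DifferentiableAt.differentiableWithinAt ?_
      rw [closure_ball _ (hR 0).ne', mem_closedBall_iff_norm] at hx
      refine DifferentiableAt.const_mul ?_ _
      refine DifferentiableAt.comp (g := h) x (hh _ fun i => ?_) ?_
      · refine Fin.cases ?_ (fun j => ?_) i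
        · simpa using hx
        · simpa using (hR j.succ).le
      · refine differentiableAt_pi.2 fun i => ?_
        refine Fin.cases ?_ (fun j => ?_) i
        · simp
        · simp
    rw [hd.circleIntegral_sub_inv_smul (Metric.mem_ball_self (hR 0)), Function.update_eq_self,
      smul_eq_mul]
    ring

theorem hasFDerivAt_torusMap {n : ℕ} (c : Fin n → ℂ) (R : Fin n → ℝ) (θ : Fin n → ℝ) :
    HasFDerivAt (torusMap c R) (ContinuousLinearMap.pi fun i =>
      (ContinuousLinearMap.proj (R := ℝ) (φ := fun _ : Fin n => ℝ) i).smulRight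
        ((R i : ℂ) * Complex.exp (θ i * Complex.I) * Complex.I)) θ := by
  refine hasFDerivAt_pi.2 fun i => ?_
  have h1 : HasDerivAt (fun t : ℝ => c i + R i * Complex.exp (t * Complex.I))
      ((R i : ℂ) * Complex.exp (θ i * Complex.I) * Complex.I) (θ i) := by
    have := ((((hasDerivAt_id (θ i)).ofReal_comp.mul_const Complex.I).cexp).const_mul
      (R i : ℂ)).const_add (c i)
    simpa [mul_assoc] using this
  have h2 : HasFDerivAt (fun θ : Fin n → ℝ => θ i)
      (ContinuousLinearMap.proj (R := ℝ) (φ := fun _ : Fin n => ℝ) i) θ := hasFDerivAt_apply i θ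
  have h3 := h1.hasFDerivAt.comp θ h2
  exact h3.congr_fderiv (by ext; simp)

/-- Change of variables for a linear image of a torus. -/
theorem pullbackForm_mulVec_torusMap {n : ℕ} (F : (Fin n → ℂ) → ℂ) (A : Matrix (Fin n) (Fin n) ℂ)
    (c : Fin n → ℂ) (R : Fin n → ℝ) (θ : Fin n → ℝ) :
    pullbackForm F (fun θ => A.mulVec (torusMap c R θ)) θ =
      (∏ i, (R i : ℂ) * Complex.exp (θ i * Complex.I) * Complex.I) *
        (A.det * F (A.mulVec (torusMap c R θ))) := by
  have hd : HasFDerivAt (fun θ => A.mulVec (torusMap c R θ)) _ θ :=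
    ((LinearMap.toContinuousLinearMap (A.mulVecLin.restrictScalars ℝ)).hasFDerivAt).comp θ
      (hasFDerivAt_torusMap c R θ)
  -- Each torus coordinate depends on its own angle only, so the Jacobian of the torus is diagonal;
  -- its determinant is the weight built into `torusIntegral`.
  have hm : (Matrix.of fun i j : Fin n =>
      fderiv ℝ (fun θ => A.mulVec (torusMap c R θ)) θ (Pi.single j 1) i) =
      A * Matrix.diagonal fun i => (R i : ℂ) * Complex.exp (θ i * Complex.I) * Complex.I := by
    ext i j
    rw [hd.fderiv]
    simp [Matrix.mulVec, dotProduct, Matrix.mul_diagonal, Pi.single_apply]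
  rw [pullbackForm, hm, Matrix.det_mul, Matrix.det_diagonal]
  ring

theorem contourIntegral_mulVec_torusMap {n : ℕ} (F : (Fin n → ℂ) → ℂ)
    (A : Matrix (Fin n) (Fin n) ℂ) (c : Fin n → ℂ) (R : Fin n → ℝ) :
    contourIntegral F (fun θ => A.mulVec (torusMap c R θ)) =
      torusIntegral (fun x => A.det * F (A.mulVec x)) c R := by
  simp only [contourIntegral, pullbackForm_mulVec_torusMap]
  rfl

theorem contourIntegrable_mulVec_torusMap {n : ℕ} {F : (Fin n → ℂ) → ℂ}
    {A : Matrix (Fin n) (Fin n) ℂ} {c : Fin n → ℂ} {R : Fin n → ℝ}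
    (hF : ∀ θ, ContinuousAt F (A.mulVec (torusMap c R θ))) :
    ContourIntegrable F (fun θ => A.mulVec (torusMap c R θ)) := by
  have hc : Continuous fun θ => A.mulVec (torusMap c R θ) := by
    unfold torusMap; fun_prop
  have hF' : Continuous fun θ => F (A.mulVec (torusMap c R θ)) :=
    continuous_iff_continuousAt.2 fun θ => ContinuousAt.comp (hF θ) hc.continuousAt
  refine ContinuousOn.integrableOn_compact isCompact_Icc (Continuous.continuousOn ?_)
  rw [funext (pullbackForm_mulVec_torusMap F A c R)]
  exact Continuous.mul (by fun_prop) (continuous_const.mul hF')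


/-! ### A nonzero class in `H¹(CP¹, 𝒪(-2))` -/

theorem mem_chart_mk {n : ℕ} {i : Fin n} {z : Fin n → ℂ} (hz : z ≠ 0) :
    Projectivization.mk ℂ z hz ∈ chart i ↔ z i ≠ 0 := by
  obtain ⟨a, ha⟩ := Projectivization.exists_smul_eq_mk_rep ℂ z hz
  rw [chart, Set.mem_ofPred_eq, ← ha]
  simp [Units.smul_def]

theorem mem_cone_chart {n : ℕ} {i : Fin n} {z : Fin n → ℂ} : z ∈ cone (chart i) ↔ z i ≠ 0 := by
  constructor
  · rintro ⟨hz, h⟩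
    exact (mem_chart_mk hz).1 h
  · intro h
    have hz : z ≠ 0 := fun h0 => h (by simp [h0])
    exact ⟨hz, (mem_chart_mk hz).2 h⟩

theorem mem_cone_inter {n : ℕ} {U V : Set (CP n)} {z : Fin n → ℂ} :
    z ∈ cone (U ∩ V) ↔ z ∈ cone U ∧ z ∈ cone V :=
  ⟨fun ⟨h, hU, hV⟩ => ⟨⟨h, hU⟩, ⟨h, hV⟩⟩, fun ⟨⟨h, hU⟩, ⟨_, hV⟩⟩ => ⟨h, hU, hV⟩⟩

theorem restrict_apply {n : ℕ} {k : ℤ} {U V : Set (CP n)} (h : V ⊆ U) (f : sections k U)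
    {z : Fin n → ℂ} (hz : z ∈ cone V) : (restrict k h f).1 z = f.1 z :=
  Set.indicator_of_mem hz f.1

theorem sections_ext {n : ℕ} {k : ℤ} {U : Set (CP n)} {f g : sections k U}
    (h : ∀ z ∈ cone U, f.1 z = g.1 z) : f = g := by
  refine Subtype.ext (funext fun z => ?_)
  by_cases hz : z ∈ cone U
  · exact h z hz
  · rw [f.2.2.2 z hz, g.2.2.2 z hz]

/-- On `CP 1` with its standard covering, an alternating `1`-cochain of `𝒪(-2)`
with component `K / (z₀ z₁)` on `U₀ ∩ U₁`. -/
noncomputable def invProdCochain (K : ℂ) : Cochain1 (-2) (chart : Fin 2 → Set (CP 2)) := fun i j =>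
  ⟨(cone (chart i ∩ chart j)).indicator fun z =>
      -- The factor `j - i` is itself an additive cocycle, equals `1` at `(0, 1)`, and vanishes on
      -- the diagonal, where `K / (z₀ z₁)` need not be holomorphic.
      (((j : ℕ) : ℂ) - ((i : ℕ) : ℂ)) * (K / (z 0 * z 1)), by
    have hc : ∀ z ∈ cone (chart i ∩ chart j), i ≠ j → z 0 ≠ 0 ∧ z 1 ≠ 0 := by
      intro z hz hij
      rw [mem_cone_inter, mem_cone_chart, mem_cone_chart] at hz
      fin_cases i <;> fin_cases j <;> simp_all
    refine ⟨?_, fun z hz c hc0 => ?_, fun z hz => Set.indicator_of_notMem hz _⟩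
    · refine DifferentiableOn.congr (f := fun z : Fin 2 → ℂ =>
        (((j : ℕ) : ℂ) - ((i : ℕ) : ℂ)) * (K / (z 0 * z 1))) ?_
        fun z hz => Set.indicator_of_mem hz _
      intro z hz
      by_cases hij : i = j
      · simpa [hij] using differentiableWithinAt_const (0 : ℂ)
      · obtain ⟨h0, h1⟩ := hc z hz hij
        refine DifferentiableAt.differentiableWithinAt ?_
        fun_prop (disch := simp [h0, h1])
    · rw [Set.indicator_of_mem hz, Set.indicator_of_mem (smul_mem_cone hz hc0)]
      by_cases hij : i = j
      · simp [hij]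
      · obtain ⟨h0, h1⟩ := hc z hz hij
        simp only [Pi.smul_apply, smul_eq_mul, zpow_neg]
        norm_cast
        field_simp⟩

theorem invProdCochain_apply (K : ℂ) {i j : Fin 2} {z : Fin 2 → ℂ}
    (hz : z ∈ cone (chart i ∩ chart j)) :
    (invProdCochain K i j).1 z = (((j : ℕ) : ℂ) - ((i : ℕ) : ℂ)) * (K / (z 0 * z 1)) :=
  Set.indicator_of_mem (s := cone (chart i ∩ chart j)) hz fun z : Fin 2 → ℂ =>
    (((j : ℕ) : ℂ) - ((i : ℕ) : ℂ)) * (K / (z 0 * z 1))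

theorem invProdCochain_zero_one (K : ℂ) {z : Fin 2 → ℂ} (h : ∀ A, z A ≠ 0) :
    (invProdCochain K 0 1).1 z = K / (z 0 * z 1) := by
  rw [invProdCochain_apply K
    (mem_cone_inter.2 ⟨mem_cone_chart.2 (h 0), mem_cone_chart.2 (h 1)⟩)]
  simp

theorem invProdCochain_mem_cocycle (K : ℂ) :
    invProdCochain K ∈ Cocycle1 (-2) (chart : Fin 2 → Set (CP 2)) := by
  rw [LinearMap.mem_ker]
  funext i j l
  refine sections_ext fun z hz => ?_
  obtain ⟨hij, hl⟩ := mem_cone_inter.1 hz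
  obtain ⟨hi, hj⟩ := mem_cone_inter.1 hij
  change (restrict (-2) _ (invProdCochain K j l)).1 z - (restrict (-2) _ (invProdCochain K i l)).1 z
    + (restrict (-2) _ (invProdCochain K i j)).1 z = 0
  rw [restrict_apply _ _ hz, restrict_apply _ _ hz, restrict_apply _ _ hz,
    invProdCochain_apply K (mem_cone_inter.2 ⟨hj, hl⟩),
    invProdCochain_apply K (mem_cone_inter.2 ⟨hi, hl⟩), invProdCochain_apply K hij]
  ring

/-- `K / (z₀ z₁)` is not a coboundary: in the coordinate `t = z₀ / z₁`, a splitting would make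
`t f₁(t, 1) - K` an entire function that vanishes at infinity. -/
theorem invProdCochain_notMem_range {K : ℂ} (hK : K ≠ 0) :
    invProdCochain K ∉ LinearMap.range (d0 (-2) (chart : Fin 2 → Set (CP 2))) := by
  rintro ⟨g, hg⟩
  have hsplit : ∀ z : Fin 2 → ℂ, (∀ A, z A ≠ 0) →
      (g 1).1 z - (g 0).1 z = K / (z 0 * z 1) := by
    intro z hz
    have hz' : z ∈ cone (chart (0 : Fin 2) ∩ chart 1) :=
      mem_cone_inter.2 ⟨mem_cone_chart.2 (hz 0), mem_cone_chart.2 (hz 1)⟩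
    rw [← invProdCochain_zero_one K hz, ← hg]
    change _ = (restrict (-2) _ (g 1)).1 z - (restrict (-2) _ (g 0)).1 z
    rw [restrict_apply _ _ hz', restrict_apply _ _ hz']
  have hopen : ∀ i : Fin 2, IsOpen (cone (chart i)) := fun i => by
    have : cone (chart i) = {z : Fin 2 → ℂ | z i ≠ 0} := Set.ext fun z => mem_cone_chart
    rw [this]
    exact isOpen_ne_fun (continuous_apply i) continuous_const
  have hdiff : ∀ (i : Fin 2) (z : Fin 2 → ℂ), z i ≠ 0 → DifferentiableAt ℂ (g i).1 z :=
    fun i z hz => (g i).2.1.differentiableAt ((hopen i).mem_nhds (mem_cone_chart.2 hz))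
  have hvec : ∀ t : ℂ, DifferentiableAt ℂ (fun t : ℂ => (![t, 1] : Fin 2 → ℂ)) t ∧
      DifferentiableAt ℂ (fun t : ℂ => (![1, t] : Fin 2 → ℂ)) t := fun t => by
    constructor <;> refine differentiableAt_pi.2 fun i => ?_ <;> fin_cases i <;> simp
  have hE : Differentiable ℂ fun t : ℂ => t * (g 1).1 ![t, 1] - K := fun t =>
    (differentiableAt_id.mul
      (DifferentiableAt.comp (g := (g 1).1) t (hdiff 1 _ (by simp)) (hvec t).1)).sub_const K
  have hG : ContinuousAt (fun s : ℂ => s * (g 0).1 ![1, s]) 0 :=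
    (continuousAt_id.mul
      (DifferentiableAt.comp (g := (g 0).1) 0 (hdiff 0 _ (by simp)) (hvec 0).2).continuousAt)
  -- Multiply the splitting at `(t, 1)` by `t` and use that `g 0` is homogeneous of degree `-2`. The
  -- right side is `s g₀(1, s)` at `s = t⁻¹`, which tends to `0` as `s → 0`.
  have hEG : ∀ t : ℂ, t ≠ 0 →
      t * (g 1).1 ![t, 1] - K = t⁻¹ * (g 0).1 ![1, t⁻¹] := by
    intro t ht
    have h1 := hsplit ![t, 1] (by intro A; fin_cases A <;> simp [ht])
    have h2 := (g 0).2.2.1 ![1, t⁻¹] (mem_cone_chart.2 (by simp)) t ht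
    have h3 : t • (![1, t⁻¹] : Fin 2 → ℂ) = ![t, 1] := by
      ext A; fin_cases A <;> simp [ht]
    rw [h3] at h2
    rw [h2] at h1
    rw [sub_eq_iff_eq_add.1 h1]
    simp only [zpow_neg, Matrix.cons_val_zero, Matrix.cons_val_one]
    norm_cast
    field_simp
    ring
  have hlim : Filter.Tendsto (fun t : ℂ => t * (g 1).1 ![t, 1] - K)
      (Filter.cocompact ℂ) (nhds 0) := by
    have h0 : Filter.Tendsto (fun t : ℂ => t⁻¹ * (g 0).1 ![1, t⁻¹])
        (Filter.cocompact ℂ) (nhds 0) := by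
      have := hG.tendsto.comp (Filter.tendsto_inv₀_cobounded (α := ℂ))
      simpa [Metric.cobounded_eq_cocompact, Function.comp_def] using this
    refine h0.congr' ?_
    have : ∀ᶠ t : ℂ in Filter.cocompact ℂ, t ≠ 0 := by
      rw [← Metric.cobounded_eq_cocompact]
      exact Bornology.eventually_ne_cobounded 0
    filter_upwards [this] with t ht using (hEG t ht).symm
  -- Liouville: the entire function vanishes identically, but its value at `t = 0` is `-K`.
  have := hE.apply_eq_of_tendsto_cocompact 0 hlim
  simp [hK] at this

theorem cechClass_invProdCochain_ne_zero {K : ℂ} (hK : K ≠ 0) :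
    cechClass (-2) (chart : Fin 2 → Set (CP 2))
      ⟨invProdCochain K, invProdCochain_mem_cocycle K⟩ ≠ 0 := by
  rw [cechClass, Submodule.mkQ_apply, Ne, Submodule.Quotient.mk_eq_zero]
  exact invProdCochain_notMem_range hK


/-! ### The collinear contour integral -/

section Collinear

variable {Z₁ Z₂ Z₃ : Fin 4 → ℂ}

/-- The matrix of the change of variables `(v, w) ↦ (v Z₂₀ + w Z₃₀, v Z₂₁ + w Z₃₁)`. -/
def collinearMatrix (Z₂ Z₃ : Fin 4 → ℂ) : Matrix (Fin 2) (Fin 2) ℂ :=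
  !![Z₂ 0, Z₃ 0; Z₂ 1, Z₃ 1]

theorem isUnit_det_collinearMatrix (hD : Z₂ 0 * Z₃ 1 - Z₂ 1 * Z₃ 0 ≠ 0) :
    IsUnit (collinearMatrix Z₂ Z₃).det := by
  rw [isUnit_iff_ne_zero, collinearMatrix, Matrix.det_fin_two_of]
  convert hD using 1
  ring

theorem inv_collinearMatrix_mulVec (hD : Z₂ 0 * Z₃ 1 - Z₂ 1 * Z₃ 0 ≠ 0) (x : Fin 2 → ℂ) :
    (collinearMatrix Z₂ Z₃)⁻¹.mulVec x 0 * Z₂ 0 + (collinearMatrix Z₂ Z₃)⁻¹.mulVec x 1 * Z₃ 0 =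
      x 0 ∧
    (collinearMatrix Z₂ Z₃)⁻¹.mulVec x 0 * Z₂ 1 + (collinearMatrix Z₂ Z₃)⁻¹.mulVec x 1 * Z₃ 1 =
      x 1 := by
  have h : (collinearMatrix Z₂ Z₃).mulVec ((collinearMatrix Z₂ Z₃)⁻¹.mulVec x) = x := by
    rw [Matrix.mulVec_mulVec, Matrix.mul_nonsing_inv _ (isUnit_det_collinearMatrix hD),
      Matrix.one_mulVec]
  generalize (collinearMatrix Z₂ Z₃)⁻¹.mulVec x = y at h ⊢
  constructor
  · have := congrFun h 0
    simp [collinearMatrix, Matrix.mulVec, dotProduct, Fin.sum_univ_two] at this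
    linear_combination this
  · have := congrFun h 1
    simp [collinearMatrix, Matrix.mulVec, dotProduct, Fin.sum_univ_two] at this
    linear_combination this

theorem continuous_inv_collinearMatrix_mulVec (i : Fin 2) :
    Continuous fun x => (collinearMatrix Z₂ Z₃)⁻¹.mulVec x i := by
  simp only [Matrix.mulVec, dotProduct, Fin.sum_univ_two]
  fun_prop

theorem differentiable_inv_collinearMatrix_mulVec (i : Fin 2) :
    Differentiable ℂ fun x => (collinearMatrix Z₂ Z₃)⁻¹.mulVec x i := by
  simp only [Matrix.mulVec, dotProduct, Fin.sum_univ_two]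
  fun_prop

/-- The four quantities are continuous in `(a, b)` and nonzero at the centre, hence nonzero on a
neighbourhood. Balls in the sup metric are polydiscs, so a single `r` bounds both radii. -/
theorem exists_surroundsOnly (hD : Z₂ 0 * Z₃ 1 - Z₂ 1 * Z₃ 0 ≠ 0) {v w : ℂ}
    (h0 : v * Z₂ 0 + w * Z₃ 0 = Z₁ 0) (h1 : v * Z₂ 1 + w * Z₃ 1 = Z₁ 1) (hv : v ≠ 0) (hw : w ≠ 0)
    (h2 : Z₁ 2 - v * Z₂ 2 - w * Z₃ 2 ≠ 0) (h3 : Z₁ 3 - v * Z₂ 3 - w * Z₃ 3 ≠ 0) :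
    ∃ r : ℝ, 0 < r ∧ ∀ ε : Fin 2 → ℝ, 0 < ε 0 → ε 0 < r → 0 < ε 1 → ε 1 < r →
      SurroundsOnly Z₁ Z₂ Z₃ ε := by
  have hinv : ∀ v w : ℂ, (collinearMatrix Z₂ Z₃)⁻¹.mulVec
      ![v * Z₂ 0 + w * Z₃ 0, v * Z₂ 1 + w * Z₃ 1] = ![v, w] := by
    intro v w
    have : ![v * Z₂ 0 + w * Z₃ 0, v * Z₂ 1 + w * Z₃ 1] =
        (collinearMatrix Z₂ Z₃).mulVec ![v, w] := by
      ext i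
      fin_cases i <;> simp [collinearMatrix]
    rw [this, Matrix.mulVec_mulVec, Matrix.nonsing_inv_mul _ (isUnit_det_collinearMatrix hD),
      Matrix.one_mulVec]
  have hc := hinv v w
  rw [h0, h1] at hc
  set y : (Fin 2 → ℂ) → Fin 2 → ℂ := fun x => (collinearMatrix Z₂ Z₃)⁻¹.mulVec x with hy
  have hcy : ∀ i, Continuous fun x => y x i := continuous_inv_collinearMatrix_mulVec
  have hev : ∀ g : (Fin 2 → ℂ) → ℂ, Continuous g → g ![v, w] ≠ 0 →
      ∀ᶠ x in nhds ![Z₁ 0, Z₁ 1], g (y x) ≠ 0 := by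
    intro g hg hne
    refine (hg.comp (continuous_pi hcy)).continuousAt.eventually_ne ?_
    change g (y _) ≠ 0
    rw [show y ![Z₁ 0, Z₁ 1] = ![v, w] from hc]
    exact hne
  obtain ⟨r, hr, hball⟩ := Metric.eventually_nhds_iff.1
    ((hev (fun x => x 0) (by fun_prop) hv).and ((hev (fun x => x 1) (by fun_prop) hw).and
      ((hev (fun x => Z₁ 2 - x 0 * Z₂ 2 - x 1 * Z₃ 2) (by fun_prop) h2).and
        (hev (fun x => Z₁ 3 - x 0 * Z₂ 3 - x 1 * Z₃ 3) (by fun_prop) h3))))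
  refine ⟨r, hr, fun ε hε0 hεr0 hε1 hεr1 => ⟨hε0, hε1, fun v' w' hv' hw' => ?_⟩⟩
  have := hball (y := ![v' * Z₂ 0 + w' * Z₃ 0, v' * Z₂ 1 + w' * Z₃ 1]) ?_
  · simpa only [hy, hinv, Matrix.cons_val_zero, Matrix.cons_val_one] using this
  · rw [dist_pi_lt_iff hr]
    intro i
    rw [dist_comm, dist_eq_norm]
    fin_cases i
    · simpa [sub_sub] using hv'.trans_lt hεr0
    · simpa [sub_sub] using hw'.trans_lt hεr1

/-- Transports admissibility from `(v, w)` to the closed polydisc in `(a, b)`, where Cauchy's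
formula is applied. -/
theorem SurroundsOnly.ne_zero {ε : Fin 2 → ℝ} (hε : SurroundsOnly Z₁ Z₂ Z₃ ε)
    (hD : Z₂ 0 * Z₃ 1 - Z₂ 1 * Z₃ 0 ≠ 0) {x : Fin 2 → ℂ}
    (hx : ∀ i, ‖x i - ![Z₁ 0, Z₁ 1] i‖ ≤ ε i) {y : Fin 2 → ℂ}
    (hy : (collinearMatrix Z₂ Z₃)⁻¹.mulVec x = y) :
    y 0 ≠ 0 ∧ y 1 ≠ 0 ∧ Z₁ 2 - y 0 * Z₂ 2 - y 1 * Z₃ 2 ≠ 0 ∧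
      Z₁ 3 - y 0 * Z₂ 3 - y 1 * Z₃ 3 ≠ 0 := by
  obtain ⟨h0, h1⟩ := inv_collinearMatrix_mulVec hD x
  rw [hy] at h0 h1
  refine hε.2.2 _ _ ?_ ?_
  · rw [sub_sub, h0, norm_sub_rev]
    exact hx 0
  · rw [sub_sub, h1, norm_sub_rev]
    exact hx 1

theorem collinearIntegrand_eq (x : Fin 2 → ℂ) :
    collinearIntegrand Z₁ Z₂ Z₃ x = 1 / (2 * (Real.pi : ℂ) * Complex.I) ^ 4 *
      (x 0 * x 1 * ((Z₁ 0 - x 0 * Z₂ 0 - x 1 * Z₃ 0) * (Z₁ 1 - x 0 * Z₂ 1 - x 1 * Z₃ 1) *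
        (Z₁ 2 - x 0 * Z₂ 2 - x 1 * Z₃ 2) * (Z₁ 3 - x 0 * Z₂ 3 - x 1 * Z₃ 3)))⁻¹ := by
  simp only [collinearIntegrand, complexDelta, Fin.prod_univ_four, Pi.sub_apply, Pi.smul_apply,
    smul_eq_mul, one_div, mul_inv]
  ring

theorem SurroundsOnly.radius_pos {ε : Fin 2 → ℝ} (hε : SurroundsOnly Z₁ Z₂ Z₃ ε) (i : Fin 2) :
    0 < ε i := by
  fin_cases i
  exacts [hε.1, hε.2.1]

theorem SurroundsOnly.contourIntegrable {ε : Fin 2 → ℝ} (hε : SurroundsOnly Z₁ Z₂ Z₃ ε)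
    (hD : Z₂ 0 * Z₃ 1 - Z₂ 1 * Z₃ 0 ≠ 0) :
    ContourIntegrable (collinearIntegrand Z₁ Z₂ Z₃) (collinearContour Z₁ Z₂ Z₃ ε) := by
  refine contourIntegrable_mulVec_torusMap fun θ => ?_
  change ContinuousAt _ ((collinearMatrix Z₂ Z₃)⁻¹.mulVec _)
  have hn := norm_torusMap_sub (c := ![Z₁ 0, Z₁ 1]) hε.radius_pos θ
  obtain ⟨h0, h1⟩ := inv_collinearMatrix_mulVec hD (torusMap ![Z₁ 0, Z₁ 1] ε θ)
  generalize hy : (collinearMatrix Z₂ Z₃)⁻¹.mulVec (torusMap ![Z₁ 0, Z₁ 1] ε θ) = y at h0 h1 ⊢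
  obtain ⟨hv, hw, h2, h3⟩ := hε.ne_zero hD (fun i => (hn i).le) hy
  -- On the torus itself the two surrounded factors have modulus exactly `ε 0` and `ε 1`.
  have h0' : Z₁ 0 - y 0 * Z₂ 0 - y 1 * Z₃ 0 ≠ 0 := by
    rw [← norm_pos_iff, sub_sub, h0, norm_sub_rev]
    exact (hε.radius_pos 0).trans_eq (hn 0).symm
  have h1' : Z₁ 1 - y 0 * Z₂ 1 - y 1 * Z₃ 1 ≠ 0 := by
    rw [← norm_pos_iff, sub_sub, h1, norm_sub_rev]
    exact (hε.radius_pos 1).trans_eq (hn 1).symm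
  rw [funext collinearIntegrand_eq]
  refine continuousAt_const.mul (ContinuousAt.inv₀ (by fun_prop) ?_)
  simp only [mul_ne_zero_iff]
  tauto

theorem SurroundsOnly.collinearDelta_eq {ε : Fin 2 → ℝ} (hε : SurroundsOnly Z₁ Z₂ Z₃ ε)
    (hD : Z₂ 0 * Z₃ 1 - Z₂ 1 * Z₃ 0 ≠ 0) {v w : ℂ}
    (h0 : v * Z₂ 0 + w * Z₃ 0 = Z₁ 0) (h1 : v * Z₂ 1 + w * Z₃ 1 = Z₁ 1) :
    collinearDelta Z₁ Z₂ Z₃ ε = 1 / (2 * (Real.pi : ℂ) * Complex.I) ^ 2 *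
      ((Z₂ 0 * Z₃ 1 - Z₂ 1 * Z₃ 0) * (v * w *
        ((Z₁ 2 - v * Z₂ 2 - w * Z₃ 2) * (Z₁ 3 - v * Z₂ 3 - w * Z₃ 3))))⁻¹ := by
  set D := Z₂ 0 * Z₃ 1 - Z₂ 1 * Z₃ 0 with hDdef
  set y : (Fin 2 → ℂ) → Fin 2 → ℂ := fun x => (collinearMatrix Z₂ Z₃)⁻¹.mulVec x with hy
  have hdet : (collinearMatrix Z₂ Z₃)⁻¹.det = D⁻¹ := by
    rw [Matrix.det_nonsing_inv, Ring.inverse_eq_inv', collinearMatrix, Matrix.det_fin_two_of, hDdef]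
    ring
  have hyd : ∀ i, Differentiable ℂ fun x => y x i := differentiable_inv_collinearMatrix_mulVec
  have hyc : y ![Z₁ 0, Z₁ 1] 0 = v ∧ y ![Z₁ 0, Z₁ 1] 1 = w := by
    obtain ⟨e0, e1⟩ := inv_collinearMatrix_mulVec hD ![Z₁ 0, Z₁ 1]
    change y _ 0 * _ + y _ 1 * _ = Z₁ 0 at e0
    change y _ 0 * _ + y _ 1 * _ = Z₁ 1 at e1
    -- Both pairs solve the same linear system; Cramer's rule identifies them.
    constructor <;> refine mul_right_cancel₀ hD ?_ <;> rw [hDdef]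
    · linear_combination Z₃ 1 * (e0 - h0) - Z₃ 0 * (e1 - h1)
    · linear_combination Z₂ 0 * (e1 - h1) - Z₂ 1 * (e0 - h0)
  change contourIntegral _ (fun θ => (collinearMatrix Z₂ Z₃)⁻¹.mulVec _) = _
  rw [contourIntegral_mulVec_torusMap, hdet]
  -- Here `h` is the integrand without its two poles at the centre, with the Jacobian `D⁻¹`
  -- included.
  have hcauchy := torusIntegral_inv_prod_sub_mul (n := 2) (c := ![Z₁ 0, Z₁ 1]) hε.radius_pos
    (h := fun x => 1 / (2 * (Real.pi : ℂ) * Complex.I) ^ 4 * (D * (y x 0 * y x 1 *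
      ((Z₁ 2 - y x 0 * Z₂ 2 - y x 1 * Z₃ 2) * (Z₁ 3 - y x 0 * Z₂ 3 - y x 1 * Z₃ 3))))⁻¹) ?_
  · rw [hyc.1, hyc.2] at hcauchy
    have hpi : (2 * (Real.pi : ℂ) * Complex.I) ≠ 0 := Complex.two_pi_I_ne_zero
    calc _ = _ := ?_
      _ = _ := hcauchy
      _ = _ := by field_simp
    congr 1
    funext x
    obtain ⟨e0, e1⟩ := inv_collinearMatrix_mulVec hD x
    change y x 0 * _ + y x 1 * _ = _ at e0
    change y x 0 * _ + y x 1 * _ = _ at e1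
    change D⁻¹ * collinearIntegrand Z₁ Z₂ Z₃ (y x) = _
    rw [collinearIntegrand_eq, sub_sub (Z₁ 0), e0, sub_sub (Z₁ 1), e1, Fin.prod_univ_two]
    simp only [Matrix.cons_val_zero, Matrix.cons_val_one]
    -- The sign changes in the two polar factors cancel.
    rw [show (x 0 - Z₁ 0) * (x 1 - Z₁ 1) = (Z₁ 0 - x 0) * (Z₁ 1 - x 1) by ring]
    simp only [mul_inv]
    ring
  · intro x hx
    obtain ⟨hv, hw, h2, h3⟩ := hε.ne_zero hD hx (y := y x) rfl
    have d0 := hyd 0 x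
    have d1 := hyd 1 x
    clear_value y D
    have hd : DifferentiableAt ℂ (fun x => D * (y x 0 * y x 1 *
        ((Z₁ 2 - y x 0 * Z₂ 2 - y x 1 * Z₃ 2) * (Z₁ 3 - y x 0 * Z₂ 3 - y x 1 * Z₃ 3)))) x := by
      fun_prop
    exact (hd.fun_inv (mul_ne_zero hD (mul_ne_zero (mul_ne_zero hv hw)
      (mul_ne_zero h2 h3)))).const_mul _

end Collinear

end TwistorDelta

open TwistorDelta in
theorem mainTheorem7 (p₁ p₂ p₃ : Fin 2 → ℂ)
    (h12 : bracket p₁ p₂ ≠ 0) (h23 : bracket p₂ p₃ ≠ 0) (h31 : bracket p₃ p₁ ≠ 0) :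
    (∀ o₁ o₂ o₃ : Fin 2 → ℂ, (∀ A, collinearArg p₁ p₂ p₃ o₁ o₂ o₃ A ≠ 0) →
      (∃ r : ℝ, 0 < r ∧ ∀ ε : Fin 2 → ℝ, 0 < ε 0 → ε 0 < r → 0 < ε 1 → ε 1 < r →
        SurroundsOnly (twistor p₁ o₁) (twistor p₂ o₂) (twistor p₃ o₃) ε) ∧
      ∀ ε : Fin 2 → ℝ, SurroundsOnly (twistor p₁ o₁) (twistor p₂ o₂) (twistor p₃ o₃) ε →
        ContourIntegrable
          (collinearIntegrand (twistor p₁ o₁) (twistor p₂ o₂) (twistor p₃ o₃))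
          (collinearContour (twistor p₁ o₁) (twistor p₂ o₂) (twistor p₃ o₃) ε) ∧
        collinearDelta (twistor p₁ o₁) (twistor p₂ o₂) (twistor p₃ o₃) ε =
          bracket p₂ p₃ ^ 3 / (bracket p₃ p₁ * bracket p₁ p₂) *
            complexDelta 2 (collinearArg p₁ p₂ p₃ o₁ o₂ o₃)) ∧
    ∃ c : Cocycle1 (-2) (chart : Fin 2 → Set (CP 2)),
      (∀ o₁ o₂ o₃ : Fin 2 → ℂ, (∀ A, collinearArg p₁ p₂ p₃ o₁ o₂ o₃ A ≠ 0) →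
        ∀ ε : Fin 2 → ℝ, SurroundsOnly (twistor p₁ o₁) (twistor p₂ o₂) (twistor p₃ o₃) ε →
          (c.1 0 1).1 (collinearArg p₁ p₂ p₃ o₁ o₂ o₃) =
            collinearDelta (twistor p₁ o₁) (twistor p₂ o₂) (twistor p₃ o₃) ε) ∧
      cechClass (-2) (chart : Fin 2 → Set (CP 2)) c ≠ 0 := by
  -- Pairing `π̃₁ = v π̃₂ + w π̃₃` with `π̃₃` and with `π̃₂` gives `v = ⟨13⟩/⟨23⟩` and `w =
  -- ⟨21⟩/⟨23⟩`; `hsolve` is then the Schouten identity.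
  set v := -(bracket p₃ p₁ / bracket p₂ p₃) with hvdef
  set w := -(bracket p₁ p₂ / bracket p₂ p₃) with hwdef
  have hv : v ≠ 0 := neg_ne_zero.2 (div_ne_zero h31 h23)
  have hw : w ≠ 0 := neg_ne_zero.2 (div_ne_zero h12 h23)
  have hsolve : ∀ i, v * p₂ i + w * p₃ i = p₁ i := by
    intro i
    refine mul_right_cancel₀ h23 ?_
    have e1 : v * bracket p₂ p₃ = -bracket p₃ p₁ := by rw [hvdef]; field_simp
    have e2 : w * bracket p₂ p₃ = -bracket p₁ p₂ := by rw [hwdef]; field_simp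
    rw [show (v * p₂ i + w * p₃ i) * bracket p₂ p₃ =
      (v * bracket p₂ p₃) * p₂ i + (w * bracket p₂ p₃) * p₃ i by ring, e1, e2]
    simp only [bracket]
    fin_cases i <;> simp <;> ring
  have hres : ∀ (o₁ o₂ o₃ : Fin 2 → ℂ) (A : Fin 2), o₁ A - v * o₂ A - w * o₃ A =
      collinearArg p₁ p₂ p₃ o₁ o₂ o₃ A / bracket p₂ p₃ := by
    intro o₁ o₂ o₃ A
    simp only [collinearArg, Pi.add_apply, Pi.smul_apply, smul_eq_mul, hvdef, hwdef]
    field_simp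
    ring
  have hdelta : ∀ (o₁ o₂ o₃ : Fin 2 → ℂ) (ε : Fin 2 → ℝ),
      SurroundsOnly (twistor p₁ o₁) (twistor p₂ o₂) (twistor p₃ o₃) ε →
      collinearDelta (twistor p₁ o₁) (twistor p₂ o₂) (twistor p₃ o₃) ε =
        bracket p₂ p₃ ^ 3 / (bracket p₃ p₁ * bracket p₁ p₂) *
          complexDelta 2 (collinearArg p₁ p₂ p₃ o₁ o₂ o₃) := by
    intro o₁ o₂ o₃ ε hε
    rw [hε.collinearDelta_eq h23 (hsolve 0) (hsolve 1)]
    change _ * (bracket p₂ p₃ * (v * w *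
      ((o₁ 0 - v * o₂ 0 - w * o₃ 0) * (o₁ 1 - v * o₂ 1 - w * o₃ 1))))⁻¹ = _
    rw [hres, hres, complexDelta, Fin.prod_univ_two, hvdef, hwdef]
    field_simp
  refine ⟨fun o₁ o₂ o₃ ho => ⟨?_, fun ε hε => ⟨hε.contourIntegrable h23, hdelta _ _ _ _ hε⟩⟩, ?_⟩
  · refine exists_surroundsOnly h23 (hsolve 0) (hsolve 1) hv hw ?_ ?_
    · change o₁ 0 - v * o₂ 0 - w * o₃ 0 ≠ 0
      rw [hres]
      exact div_ne_zero (ho 0) h23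
    · change o₁ 1 - v * o₂ 1 - w * o₃ 1 ≠ 0
      rw [hres]
      exact div_ne_zero (ho 1) h23
  -- This constant does not involve the `ω̃`, so one cocycle serves all of them.
  · have hK : bracket p₂ p₃ ^ 3 / (bracket p₃ p₁ * bracket p₁ p₂) *
        (1 / (2 * (Real.pi : ℂ) * Complex.I) ^ 2) ≠ 0 :=
      mul_ne_zero (div_ne_zero (pow_ne_zero 3 h23) (mul_ne_zero h31 h12))
        (one_div_ne_zero (pow_ne_zero 2 Complex.two_pi_I_ne_zero))
    refine ⟨⟨invProdCochain _, invProdCochain_mem_cocycle _⟩, fun o₁ o₂ o₃ ho ε hε => ?_,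
      cechClass_invProdCochain_ne_zero hK⟩
    rw [hdelta _ _ _ _ hε]
    refine (invProdCochain_zero_one _ ho).trans ?_
    rw [complexDelta, Fin.prod_univ_two]
    ring
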